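/- For $p\le q$ and complex parameters, let $${}_p\tilde F_q(a_1,\dots,a_p;b_1,\dots,b_q;z)=\sum_{n=0}^{\infty}\frac{(a_1)_n\cdots(a_p)_n}{\Gamma(b_1+n)\cdots\Gamma(b_q+n)}\,\frac{z^n}{n!}$$ be the regularized generalized hypergeometric function, where $(x)_n=x(x+1)\cdots(x+n-1)$ and $1/\Gamma$ is read as $0$ at the poles of $\Gamma$. For $k,\lambda\in\mathbb C$ and integers $L\ge0$ put $$c_L(k,\lambda)=\frac{(-1)^{2L}k^{4L}\,2^{2L+2\lambda+1}(2L+\lambda)\,\Gamma(L+\tfrac12)\,\Gamma(\lambda+\tfrac12)\,\bigl((\lambda+\tfrac12)_{2L}\bigr)^2\,\Gamma(2L+\lambda+1)^2\,\Gamma(2L+2\lambda)}{\pi\,\Gamma(L+1)\,\Gamma(4L+2\lambda+1)^2}.$$ Let $k,\mu,\lambda\in\mathbb C$, where $\lambda\neq0$ and $\lambda$ is not a negative integer. Then $${}_2\tilde F_3\left(\tfrac12,\tfrac12;\lambda+1,1-\mu,\mu+1;-k^2\right)=\sum_{L=0}^{\infty}c_L(k,\lambda)\;{}_1\tilde F_2\left(L+\tfrac12;2L+\lambda+1,L-\mu+1;-\tfrac{k^2}{4}\right)\,{}_1\tilde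 F_2\left(L+\tfrac12;2L+\lambda+1,L+\mu+1;-\tfrac{k^2}{4}\right),$$ with absolute convergence of the series. If $\lambda\in\{-\tfrac12,-\tfrac32,-\tfrac52,\dots\}$, where Gamma factors in $c_L(k,\lambda)$ have poles, $c_L(k,\lambda)$ is read as $\lim_{\lambda'\to\lambda,\ \lambda'\ne\lambda}c_L(k,\lambda')$, and part of the claim is that this limit exists (and is finite) for every $L$. -/

import Mathlib

open Filter Topology

/-- The coefficient
`(-1)^(2L) k^(4L) 2^(2L+2λ+1) (2L+λ) Γ(L+1/2) Γ(λ+1/2) ((λ+1/2)_{2L})² Γ(2L+λ+1)² Γ(2L+2λ)`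
`/ (π Γ(L+1) Γ(4L+2λ+1)²)`.
The Pochhammer symbol `(x)_{2L}` is `(ascPochhammer ℂ (2 * L)).eval x`. -/
noncomputable def pairCoeff (k lam : ℂ) (L : ℕ) : ℂ :=
  (-1) ^ (2 * L) * k ^ (4 * L) * (2 : ℂ) ^ (2 * (L : ℂ) + 2 * lam + 1) * (2 * (L : ℂ) + lam)
      * Complex.Gamma ((L : ℂ) + 1 / 2) * Complex.Gamma (lam + 1 / 2)
      * ((ascPochhammer ℂ (2 * L)).eval (lam + 1 / 2)) ^ 2
      * Complex.Gamma (2 * (L : ℂ) + lam + 1) ^ 2 * Complex.Gamma (2 * (L : ℂ) + 2 * lam)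
    / ((Real.pi : ℂ) * Complex.Gamma ((L : ℂ) + 1) * Complex.Gamma (4 * (L : ℂ) + 2 * lam + 1) ^ 2)

/-- The product of regularized functions
`₁F̃₂(L+1/2; 2L+λ+1, L-μ+1; -k²/4) · ₁F̃₂(L+1/2; 2L+λ+1, L+μ+1; -k²/4)`. -/
noncomputable def pairProduct (k μ lam : ℂ) (L : ℕ) : ℂ :=
  Complex.regularizedHGFun {(L : ℂ) + 1 / 2} {2 * (L : ℂ) + lam + 1, (L : ℂ) - μ + 1}
      (-k ^ 2 / 4)
    * Complex.regularizedHGFun {(L : ℂ) + 1 / 2} {2 * (L : ℂ) + lam + 1, (L : ℂ) + μ + 1}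
      (-k ^ 2 / 4)

/-!
Both sides are sums of one absolutely convergent triple series. Write `z = -k²/4` and expand the two
`₁F̃₂` factors with summation indices `i` and `j`. In terms of `p = L + i` and `q = L + j` the
Gamma factors that contain `μ` become `Γ(p-μ+1)` and `Γ(q+μ+1)`, which no longer depend on `L`, and
`(1/2)_L (L+1/2)_i = (1/2)_p`. The duplication formula turns the coefficient into
`k^(4L) 16^(-L) ((1/2)_L)² Γ(λ) (2L+λ) (2λ)_{2L} / (2L)!` (`pairCoeff_eq_pairCoeffClosed`), and the
resulting terms are `tripleTerm`.

For fixed `p` and `q` the sum over `L` is a terminating very well-poised `₅F₄` at `1`, with value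
proportional to `(1/2)_{p+q} / ((1/2)_p (1/2)_q Γ(λ+1+p+q))`; this is `sum_range_wellPoisedTerm`,
proved by telescoping. What is left depends on `p` and `q` separately only through
`1 / (p! q! Γ(p-μ+1) Γ(q+μ+1))`, and the sum of this over `p + q = N` is the Chu–Vandermonde
identity `sum_antidiagonal_inv_Gamma`. The outcome is the coefficient of `(-k²)^N` in `₂F̃₃`.

The rearrangement is justified by `summable_tripleTerm`, where `1/Γ(s+n) = O(2^n/n!)` and
`(s)_n = O(2^n n!)` bound the triple series by a product of three exponential series. The closed
form of the coefficient is continuous in `λ` away from the poles of `Γ(λ)`, hence at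
`λ = -n - 1/2`, which gives the limits there.
-/

/-- The Pochhammer symbol `(x)_n`. -/
local notation "poch(" n ", " x ")" => Polynomial.eval x (ascPochhammer ℂ n)

/-! ### Pochhammer symbols and the Gamma function -/

theorem ascPochhammer_eval_add (x : ℂ) (m n : ℕ) :
    poch(m + n, x) = poch(m, x) * poch(n, x + m) := by
  rw [← ascPochhammer_mul]
  simp

theorem ascPochhammer_eval_ne_zero {x : ℂ} (hx : ∀ m : ℕ, x ≠ -m) (n : ℕ) : poch(n, x) ≠ 0 := by
  rw [Ne, ascPochhammer_eval_eq_zero_iff]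
  rintro ⟨k, -, hk⟩
  exact hx k (by rw [hk, neg_neg])

theorem Gamma_add_nat_eq_mul_ascPochhammer {x : ℂ} (hx : ∀ m : ℕ, x ≠ -m) (n : ℕ) :
    Complex.Gamma (x + n) = Complex.Gamma x * poch(n, x) := by
  rw [← Complex.Gamma_add_nat_div_Gamma_eq x hx, mul_div_cancel₀ _ (Complex.Gamma_ne_zero hx)]

/-- Unlike `Gamma_add_nat_eq_mul_ascPochhammer` this holds for every `s`: at a pole of `Γ` Mathlib's
value `Γ = 0` makes the inverse vanish, as the entire function `1 / Γ` does. -/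
theorem inv_Gamma_eq_ascPochhammer_mul (s : ℂ) (n : ℕ) :
    (Complex.Gamma s)⁻¹ = poch(n, s) * (Complex.Gamma (s + n))⁻¹ := by
  induction n with
  | zero => simp
  | succ n ih =>
    rw [ih, ascPochhammer_succ_eval,
      Complex.one_div_Gamma_eq_self_mul_one_div_Gamma_add_one (s + n)]
    push_cast
    ring_nf

theorem half_ne_neg_natCast (m : ℕ) : (1 / 2 : ℂ) ≠ -m := by
  intro h
  have := congrArg Complex.re h
  simp at this
  have : (0:ℝ) ≤ m := m.cast_nonneg
  linarith

theorem cast_descFactorial_succ (n k : ℕ) :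
    (n.descFactorial (k + 1) : ℂ) = (n - k) * n.descFactorial k := by
  rw [Nat.descFactorial_succ]
  rcases le_or_gt k n with h | h
  · push_cast [Nat.cast_sub h]; ring
  · simp [Nat.descFactorial_of_lt h]

theorem factorial_two_mul_eq (n : ℕ) :
    ((2 * n).factorial : ℂ) = poch(n, 1 / 2) * n.factorial * 4 ^ n := by
  induction n with
  | zero => simp
  | succ n ih =>
    rw [show 2 * (n + 1) = 2 * n + 1 + 1 by ring, Nat.factorial_succ, Nat.factorial_succ,
      ascPochhammer_succ_eval, Nat.factorial_succ]
    push_cast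
    rw [ih]
    ring

/-! ### Two finite summation formulas -/

/-- The term of index `L` of the terminating very well-poised `₅F₄` series with parameters
`a, a/2 + 1, a + 1/2, -p, -q` at `1`, up to a factor independent of `L`. The falling factorials
make it vanish for `L > min p q`. -/
noncomputable def wellPoisedTerm (a : ℂ) (p q L : ℕ) : ℂ :=
  (2 * L + a) * poch(2 * L, 2 * a) / (2 * L).factorial *
    (p.descFactorial L * q.descFactorial L) / (poch(p + L, a + 1) * poch(q + L, a + 1))

/-- The Wilf–Zeilberger step in `q`: the contiguous combination of the terms for `q + 1` and `q`
telescopes in `L`. The right-hand side vanishes once `q < M`. -/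
theorem sum_range_wellPoisedTerm_contiguous {a : ℂ} (ha : ∀ m : ℕ, a + 1 ≠ -m) (p q M : ℕ) :
    ∑ L ∈ Finset.range (M + 1), ((q + 1 / 2) * (a + 1 + p + q) * wellPoisedTerm a p (q + 1) L
        - (p + q + 1 / 2) * wellPoisedTerm a p q L) =
      -(1 / 4) * (poch(2 * M + 2, 2 * a) / (2 * M).factorial) *
        (p.descFactorial (M + 1) * q.descFactorial M) /
          (poch(p + M, a + 1) * poch(q + M + 1, a + 1)) := by
  have hne : ∀ n : ℕ, a + 1 + n ≠ 0 := fun n h => ha n (eq_neg_of_add_eq_zero_left h)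
  induction M with
  | zero =>
    have h1 := ascPochhammer_eval_ne_zero ha p
    have h2 := ascPochhammer_eval_ne_zero ha q
    have h3 := hne q
    simp [wellPoisedTerm, ascPochhammer_succ_eval]
    field_simp
    ring
  | succ M ih =>
    rw [Finset.sum_range_succ, ih]
    unfold wellPoisedTerm
    have e1 : p + (M + 1) = p + M + 1 := by ring
    have e2 : q + (M + 1) = q + M + 1 := by ring
    have e3 : q + 1 + (M + 1) = q + M + 1 + 1 := by ring
    have e4 : 2 * (M + 1) = 2 * M + 1 + 1 := by ring
    have e5 : 2 * M + 2 = 2 * M + 1 + 1 := by ring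
    have h1 := ascPochhammer_eval_ne_zero ha (p + M)
    have h2 := ascPochhammer_eval_ne_zero ha (q + M)
    have h3 := hne (q + M)
    have h4 := hne (p + M)
    have h5 := hne (q + M + 1)
    have h6 : ((2 * M).factorial : ℂ) ≠ 0 := by exact_mod_cast (2 * M).factorial_ne_zero
    have h7 : (2 * M + 1 : ℂ) ≠ 0 := by exact_mod_cast (2 * M).succ_ne_zero
    have h8 : (2 * M + 1 + 1 : ℂ) ≠ 0 := by exact_mod_cast (2 * M + 1).succ_ne_zero
    rw [e1, e2, e3, e4, e5, Nat.succ_descFactorial_succ]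
    simp only [ascPochhammer_succ_eval, Nat.factorial_succ, cast_descFactorial_succ]
    push_cast at *
    field_simp
    ring

/-- The terminating very well-poised `₅F₄` summation, by induction on `q`. -/
theorem sum_range_wellPoisedTerm {a : ℂ} (ha : ∀ m : ℕ, a + 1 ≠ -m) (p q M : ℕ) (hM : q ≤ M) :
    ∑ L ∈ Finset.range (M + 1), wellPoisedTerm a p q L =
      a * poch(p + q, 1 / 2) / (poch(p, 1 / 2) * poch(q, 1 / 2) * poch(p + q, a + 1)) := by
  induction q with
  | zero =>
    rw [Finset.sum_range_succ', Finset.sum_eq_zero]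
    · have := ascPochhammer_eval_ne_zero half_ne_neg_natCast p
      simp only [wellPoisedTerm, zero_add, add_zero, mul_zero,
        Nat.descFactorial_zero, Nat.factorial_zero, ascPochhammer_zero, Polynomial.eval_one,
        Nat.cast_zero, Nat.cast_one]
      field_simp
    · intro L _
      simp [wellPoisedTerm]
  | succ q ih =>
    have hne : ∀ n : ℕ, a + 1 + n ≠ 0 := fun n h => ha n (eq_neg_of_add_eq_zero_left h)
    have hc := sum_range_wellPoisedTerm_contiguous ha p q M
    rw [Nat.descFactorial_of_lt (show q < M by omega), Finset.sum_sub_distrib, ← Finset.mul_sum,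
      ← Finset.mul_sum, ih (by omega)] at hc
    have h1 := ascPochhammer_eval_ne_zero half_ne_neg_natCast p
    have h2 := ascPochhammer_eval_ne_zero half_ne_neg_natCast q
    have h3 := ascPochhammer_eval_ne_zero ha (p + q)
    have h4 := hne (p + q)
    have h5 : (q + 1 / 2 : ℂ) ≠ 0 := by
      intro h
      exact half_ne_neg_natCast q (by linear_combination h)
    have h5' : (1 / 2 + q : ℂ) ≠ 0 := by rwa [add_comm]
    rw [← add_assoc p q 1]
    simp only [ascPochhammer_succ_eval]
    push_cast at *
    have h4' : a + 1 + p + q ≠ 0 := by rwa [← add_assoc] at h4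
    -- The telescoped sum is zero, which determines the sum for `q + 1` from the one for `q`.
    have : ∀ S T R : ℂ, ((q:ℂ) + 1 / 2) * (a + 1 + p + q) * S - R * T = 0 →
        S = R * T / ((q + 1 / 2) * (a + 1 + p + q)) := by
      intro S T R h
      rw [eq_div_iff (mul_ne_zero h5 h4')]
      linear_combination h
    rw [this _ _ _ (hc.trans (by simp)), div_eq_div_iff (by positivity) (by positivity)]
    field_simp
    ring

/-- The Chu–Vandermonde identity for the binomial coefficients `N + μ` over `p` and `N - μ` over
`q`, written with reciprocal Gamma values so that it also holds for integral `μ`. -/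
theorem sum_antidiagonal_inv_Gamma (μ : ℂ) (N : ℕ) :
    ∑ x ∈ Finset.HasAntidiagonal.antidiagonal N, ((x.1.factorial : ℂ) * x.2.factorial)⁻¹ *
        (Complex.Gamma (x.1 - μ + 1))⁻¹ * (Complex.Gamma (x.2 + μ + 1))⁻¹ =
      4 ^ N * poch(N, 1 / 2) / N.factorial *
        (Complex.Gamma (1 - μ + N))⁻¹ * (Complex.Gamma (μ + 1 + N))⁻¹ := by
  have hv := Ring.add_choose_eq N (Commute.all (N + μ) (N - μ))
  have e : (N + μ + (N - μ) : ℂ) = ((2 * N : ℕ) : ℂ) := by push_cast; ring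
  rw [e, Ring.choose_natCast, Nat.cast_choose ℂ (by omega : N ≤ 2 * N), factorial_two_mul_eq,
    show 2 * N - N = N by omega] at hv
  have hN : (N.factorial : ℂ) ≠ 0 := by exact_mod_cast N.factorial_ne_zero
  have hv' : 4 ^ N * poch(N, 1 / 2) / N.factorial =
      ∑ ij ∈ Finset.HasAntidiagonal.antidiagonal N,
        Ring.choose (N + μ) ij.1 * Ring.choose (N - μ) ij.2 := by
    rw [← hv]
    field_simp
  rw [hv', Finset.sum_mul, Finset.sum_mul]
  refine Finset.sum_congr rfl ?_
  rintro ⟨p, q⟩ hpq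
  obtain rfl : p + q = N := by simpa using hpq
  have hp : (p.factorial : ℂ) ≠ 0 := by exact_mod_cast p.factorial_ne_zero
  have hq : (q.factorial : ℂ) ≠ 0 := by exact_mod_cast q.factorial_ne_zero
  have key : ∀ (x : ℂ) (n : ℕ), Ring.choose (x + n) n = poch(n, x + 1) / n.factorial := by
    intro x n
    rw [eq_div_iff (by exact_mod_cast n.factorial_ne_zero), mul_comm, ← nsmul_eq_mul,
      ← Ring.descPochhammer_eq_factorial_smul_choose,
      Polynomial.descPochhammer_smeval_eq_ascPochhammer,
      Polynomial.ascPochhammer_smeval_eq_eval]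
    congr 1
    ring
  dsimp only
  rw [inv_Gamma_eq_ascPochhammer_mul (p - μ + 1) q, inv_Gamma_eq_ascPochhammer_mul (q + μ + 1) p,
    show ((p + q : ℕ) + μ : ℂ) = (q + μ) + p by push_cast; ring,
    show ((p + q : ℕ) - μ : ℂ) = (p - μ) + q by push_cast; ring, key, key,
    show (p - μ + 1 + q : ℂ) = 1 - μ + (p + q : ℕ) by push_cast; ring,
    show (q + μ + 1 + p : ℂ) = μ + 1 + (p + q : ℕ) by push_cast; ring]
  field_simp

/-! ### Growth estimates -/

/-- A real sequence that is eventually antitone is bounded above. -/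
theorem exists_forall_le_of_succ_le {u : ℕ → ℝ} (n₀ : ℕ) (hu : ∀ n, n₀ ≤ n → u (n + 1) ≤ u n) :
    ∃ C : ℝ, ∀ n, u n ≤ C := by
  obtain ⟨C, hC⟩ := ((Finset.range (n₀ + 1)).image u).bddAbove
  have hC' : ∀ n ≤ n₀, u n ≤ C := fun n hn =>
    hC (Finset.mem_coe.2 (Finset.mem_image_of_mem u (Finset.mem_range_succ_iff.2 hn)))
  refine ⟨C, fun n => ?_⟩
  rcases le_total n n₀ with h | h
  · exact hC' n h
  · induction n, h using Nat.le_induction with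
    | base => exact hC' n₀ le_rfl
    | succ n hn ih => exact (hu n hn).trans ih

theorem exists_norm_inv_Gamma_add_nat_le (s : ℂ) :
    ∃ C : ℝ, 0 ≤ C ∧ ∀ n : ℕ, ‖(Complex.Gamma (s + n))⁻¹‖ ≤ C * (2 ^ n / n.factorial) := by
  -- From this index on `‖s + n‖ ≥ (n + 1) / 2`.
  obtain ⟨n₀, hn₀⟩ := exists_nat_ge (2 * ‖s‖ + 1)
  obtain ⟨C, hC⟩ := exists_forall_le_of_succ_le
      (u := fun n : ℕ => ‖(Complex.Gamma (s + n))⁻¹‖ * (n.factorial / 2 ^ n)) n₀ <| by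
    intro n hn
    have hn' : (n₀ : ℝ) ≤ n := by exact_mod_cast hn
    have h1 : ((n : ℝ) + 1) / 2 ≤ ‖s + n‖ := by
      have := norm_sub_le (s + n) s
      simp at this
      linarith
    rw [Complex.one_div_Gamma_eq_self_mul_one_div_Gamma_add_one (s + n), norm_mul,
      Nat.factorial_succ, pow_succ, add_assoc]
    push_cast
    rw [show ‖(Complex.Gamma (s + (n + 1)))⁻¹‖ * (((n : ℝ) + 1) * n.factorial / (2 ^ n * 2)) =
      ((n : ℝ) + 1) / 2 * ‖(Complex.Gamma (s + (n + 1)))⁻¹‖ * (n.factorial / 2 ^ n) by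
        field_simp]
    gcongr
  refine ⟨C, le_trans (by positivity) (hC 0), fun n => ?_⟩
  have := hC n
  rw [← div_le_iff₀ (by positivity)]
  refine le_trans (le_of_eq ?_) this
  field_simp

theorem exists_norm_ascPochhammer_le (s : ℂ) :
    ∃ C : ℝ, 0 ≤ C ∧ ∀ n : ℕ, ‖poch(n, s)‖ ≤ C * (2 ^ n * n.factorial) := by
  -- From this index on `‖s + n‖ ≤ 2 (n + 1)`.
  obtain ⟨n₀, hn₀⟩ := exists_nat_ge ‖s‖
  obtain ⟨C, hC⟩ := exists_forall_le_of_succ_le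
      (u := fun n : ℕ => ‖poch(n, s)‖ / (2 ^ n * n.factorial)) n₀ <| by
    intro n hn
    have hn' : (n₀ : ℝ) ≤ n := by exact_mod_cast hn
    have h1 : ‖s + n‖ ≤ 2 * ((n : ℝ) + 1) := by
      have := norm_add_le s n
      simp at this
      linarith
    rw [ascPochhammer_succ_eval, norm_mul, Nat.factorial_succ, pow_succ,
      div_le_div_iff₀ (by positivity) (by positivity)]
    push_cast
    calc _ ≤ ‖poch(n, s)‖ * (2 * ((n : ℝ) + 1)) * (2 ^ n * n.factorial) := by gcongr
      _ = _ := by ring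
  refine ⟨C, le_trans (by positivity) (hC 0), fun n => ?_⟩
  rw [← div_le_iff₀ (by positivity)]
  exact hC n

theorem norm_ascPochhammer_half_le (n : ℕ) : ‖poch(n, (1 / 2 : ℂ))‖ ≤ n.factorial := by
  induction n with
  | zero => simp
  | succ n ih =>
    rw [ascPochhammer_succ_eval, norm_mul, Nat.factorial_succ, mul_comm]
    push_cast
    gcongr
    refine (norm_add_le _ _).trans ?_
    simp
    linarith

/-! ### The triple series -/

theorem hasSum_regularizedHGFun (a b : Multiset ℂ) (h : a.card ≤ b.card) (z : ℂ) :
    HasSum (fun n : ℕ => Complex.regularizedHGFunCoeff a b n * z ^ n)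
      (Complex.regularizedHGFun a b z) := by
  have hs : z ∈ Metric.eball (0 : ℂ) (Complex.regularizedHGFunSeries a b).radius := by
    rw [Complex.radius_regularizedHGFunSeries_eq_top h]
    simp
  have := (Complex.regularizedHGFunSeries a b).hasSum hs
  simpa [Complex.regularizedHGFun, FormalMultilinearSeries.apply_eq_pow_smul_coeff, mul_comm]
    using this

/-- The coefficient `pairCoeff` after the duplication formula for `Γ`:
`k^(4L) 16^(-L) ((1/2)_L)² Γ(λ) (2L+λ) (2λ)_{2L} / (2L)!`. Its only singularities in `λ` are the
poles of `Γ(λ)`. -/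
noncomputable def pairCoeffClosed (k lam : ℂ) (L : ℕ) : ℂ :=
  k ^ (4 * L) / 16 ^ L * poch(L, 1 / 2) ^ 2 *
    (Complex.Gamma lam * (2 * L + lam) * poch(2 * L, 2 * lam) / (2 * L).factorial)

/-- The term of the triple series behind the expansion: `L` is the index of the outer series, while
`p - L` and `q - L` are the summation indices of the two `₁F̃₂` factors. It vanishes unless
`L ≤ min p q`. -/
noncomputable def tripleTerm (z μ lam : ℂ) (p q L : ℕ) : ℂ :=
  (poch(p, 1 / 2) / p.factorial * (Complex.Gamma (p - μ + 1))⁻¹ * z ^ p) *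
    (poch(q, 1 / 2) / q.factorial * (Complex.Gamma (q + μ + 1))⁻¹ * z ^ q) *
    (Complex.Gamma lam * (2 * L + lam) * poch(2 * L, 2 * lam) / (2 * L).factorial) *
    (p.descFactorial L * (Complex.Gamma (lam + 1 + (p + L : ℕ)))⁻¹) *
    (q.descFactorial L * (Complex.Gamma (lam + 1 + (q + L : ℕ)))⁻¹)

/-- With `p = L + i` and `q = L + j` the triple series separates: the term is the coefficient times
the product of the `i`-th and `j`-th terms of the two `₁F̃₂` series. -/
theorem tripleTerm_add_left (k μ lam : ℂ) (L i j : ℕ) :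
    tripleTerm (-k ^ 2 / 4) μ lam (L + i) (L + j) L = pairCoeffClosed k lam L *
      ((Complex.regularizedHGFunCoeff {(L : ℂ) + 1 / 2} {2 * (L : ℂ) + lam + 1, (L : ℂ) - μ + 1} i *
          (-k ^ 2 / 4) ^ i) *
        (Complex.regularizedHGFunCoeff {(L : ℂ) + 1 / 2}
            {2 * (L : ℂ) + lam + 1, (L : ℂ) + μ + 1} j * (-k ^ 2 / 4) ^ j)) := by
  have hk : k ^ (4 * L) / 16 ^ L = (-k ^ 2 / 4) ^ L * (-k ^ 2 / 4) ^ L := by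
    rw [← mul_pow, pow_mul, ← div_pow]
    congr 1
    ring
  have hd : ∀ i : ℕ, ((L + i).descFactorial L : ℂ) * ((L + i).factorial : ℂ)⁻¹ =
      (i.factorial : ℂ)⁻¹ := by
    intro i
    have := Nat.factorial_mul_descFactorial (Nat.le_add_right L i)
    rw [Nat.add_sub_cancel_left] at this
    rw [← this]
    have h1 : (i.factorial : ℂ) ≠ 0 := by exact_mod_cast i.factorial_ne_zero
    have h2 : ((L + i).descFactorial L : ℂ) ≠ 0 := by
      exact_mod_cast (Nat.descFactorial_pos.2 (Nat.le_add_right L i)).ne'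
    push_cast
    field_simp
  unfold tripleTerm pairCoeffClosed Complex.regularizedHGFunCoeff
  rw [hk, ascPochhammer_eval_add _ L i, ascPochhammer_eval_add _ L j,
    show lam + 1 + ((L + i + L : ℕ) : ℂ) = 2 * L + lam + 1 + i by push_cast; ring,
    show lam + 1 + ((L + j + L : ℕ) : ℂ) = 2 * L + lam + 1 + j by push_cast; ring,
    show ((L + i : ℕ) : ℂ) - μ + 1 = L - μ + 1 + i by push_cast; ring,
    show ((L + j : ℕ) : ℂ) + μ + 1 = L + μ + 1 + j by push_cast; ring,
    add_comm (1 / 2 : ℂ) (L : ℂ)]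
  simp only [Multiset.map_singleton, Multiset.prod_singleton, Multiset.insert_eq_cons,
    Multiset.map_cons, Multiset.prod_cons, pow_add, div_eq_mul_inv, mul_inv]
  rw [← hd i, ← hd j]
  generalize ((L + i).descFactorial L : ℂ) = A
  generalize ((L + j).descFactorial L : ℂ) = B
  generalize ((L + i).factorial : ℂ)⁻¹ = A'
  generalize ((L + j).factorial : ℂ)⁻¹ = B'
  generalize ((2 * L).factorial : ℂ)⁻¹ = X
  generalize (Complex.Gamma _)⁻¹ = g1
  generalize (Complex.Gamma _)⁻¹ = g2
  generalize (Complex.Gamma _)⁻¹ = g3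
  generalize (Complex.Gamma _)⁻¹ = g4
  generalize -k ^ 2 * 4⁻¹ = z
  ring

theorem hasSum_prod_mul {f g : ℕ → ℂ} {s t : ℂ} (hf : HasSum f s) (hg : HasSum g t) :
    HasSum (fun x : ℕ × ℕ => f x.1 * g x.2) (s * t) := by
  have h : Summable fun x : ℕ × ℕ => f x.1 * g x.2 := by
    refine Summable.of_norm ?_
    simpa only [norm_mul] using
      hf.summable.norm.mul_of_nonneg hg.summable.norm (fun _ => norm_nonneg _)
        fun _ => norm_nonneg _
  exact hf.mul hg h

/-- For fixed `L`, summing over the indices of the two `₁F̃₂` factors gives the term of index `L` of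
the expansion. -/
theorem hasSum_tripleTerm_pair (k μ lam : ℂ) (L : ℕ) :
    HasSum (fun x : ℕ × ℕ => tripleTerm (-k ^ 2 / 4) μ lam (L + x.1) (L + x.2) L)
      (pairCoeffClosed k lam L * pairProduct k μ lam L) := by
  have h1 := hasSum_regularizedHGFun {(L : ℂ) + 1 / 2} {2 * (L : ℂ) + lam + 1, (L : ℂ) - μ + 1}
    (by simp) (-k ^ 2 / 4)
  have h2 := hasSum_regularizedHGFun {(L : ℂ) + 1 / 2} {2 * (L : ℂ) + lam + 1, (L : ℂ) + μ + 1}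
    (by simp) (-k ^ 2 / 4)
  have h3 := (hasSum_prod_mul h1 h2).mul_left (pairCoeffClosed k lam L)
  rw [funext fun x : ℕ × ℕ => tripleTerm_add_left k μ lam L x.1 x.2]
  exact h3

/-- For fixed `p` and `q`, the sum over `L` is the very well-poised `₅F₄` sum with `a = λ`. -/
theorem hasSum_tripleTerm_inner {lam : ℂ} (hlam : ∀ m : ℕ, lam ≠ -m) (z μ : ℂ) (p q : ℕ) :
    HasSum (fun L : ℕ => tripleTerm z μ lam p q L)
      (((p.factorial : ℂ) * q.factorial)⁻¹ * (Complex.Gamma (p - μ + 1))⁻¹ *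
        (Complex.Gamma (q + μ + 1))⁻¹ *
        (poch(p + q, 1 / 2) * (Complex.Gamma (lam + 1 + (p + q : ℕ)))⁻¹ * z ^ (p + q))) := by
  have ha : ∀ m : ℕ, lam + 1 ≠ -m := by
    intro m h
    exact hlam (m + 1) (by push_cast; linear_combination h)
  have hlam0 : lam ≠ 0 := by simpa using hlam 0
  have hG : Complex.Gamma (lam + 1) = lam * Complex.Gamma lam := Complex.Gamma_add_one _ hlam0
  have hG0 := Complex.Gamma_ne_zero hlam
  have e : ∀ L, tripleTerm z μ lam p q L =
      (poch(p, 1 / 2) / p.factorial * (Complex.Gamma (p - μ + 1))⁻¹ * z ^ p) *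
      (poch(q, 1 / 2) / q.factorial * (Complex.Gamma (q + μ + 1))⁻¹ * z ^ q) *
      (Complex.Gamma lam / Complex.Gamma (lam + 1) ^ 2) * wellPoisedTerm lam p q L := by
    intro L
    unfold tripleTerm wellPoisedTerm
    rw [Gamma_add_nat_eq_mul_ascPochhammer ha, Gamma_add_nat_eq_mul_ascPochhammer ha]
    simp only [div_eq_mul_inv, mul_inv]
    ring
  have hs : HasSum (fun L => wellPoisedTerm lam p q L)
      (∑ L ∈ Finset.range (q + 1), wellPoisedTerm lam p q L) := by
    refine hasSum_sum_of_ne_finset_zero fun L hL => ?_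
    rw [wellPoisedTerm, Nat.descFactorial_of_lt (n := q) (k := L) (by simpa using hL)]
    simp
  rw [sum_range_wellPoisedTerm ha p q q le_rfl] at hs
  simp only [e]
  have hval : ∀ {f : ℕ → ℂ} {s t : ℂ}, HasSum f s → s = t → HasSum f t := fun h e => e ▸ h
  refine hval (hs.mul_left _) ?_
  rw [Gamma_add_nat_eq_mul_ascPochhammer ha, hG]
  have h1 := ascPochhammer_eval_ne_zero half_ne_neg_natCast p
  have h2 := ascPochhammer_eval_ne_zero half_ne_neg_natCast q
  have h3 := ascPochhammer_eval_ne_zero ha (p + q)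
  rw [pow_add]
  generalize (Complex.Gamma (p - μ + 1))⁻¹ = x
  generalize (Complex.Gamma (q + μ + 1))⁻¹ = y
  have hp : (p.factorial : ℂ) ≠ 0 := by exact_mod_cast p.factorial_ne_zero
  have hq : (q.factorial : ℂ) ≠ 0 := by exact_mod_cast q.factorial_ne_zero
  field_simp

theorem summable_tripleTerm (z μ lam : ℂ) :
    Summable (fun x : (ℕ × ℕ) × ℕ => tripleTerm z μ lam x.1.1 x.1.2 x.2) := by
  obtain ⟨C₁, hC₁, h₁⟩ := exists_norm_inv_Gamma_add_nat_le (1 - μ)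
  obtain ⟨C₂, hC₂, h₂⟩ := exists_norm_inv_Gamma_add_nat_le (1 + μ)
  obtain ⟨C₃, hC₃, h₃⟩ := exists_norm_inv_Gamma_add_nat_le (lam + 1)
  obtain ⟨C₄, hC₄, h₄⟩ := exists_norm_ascPochhammer_le (2 * lam)
  set r := ‖z‖
  -- Each of the three indices contributes the general term of an exponential series.
  let F : (ℕ × ℕ) × ℕ → ℝ := fun x =>
    C₁ * C₂ * C₃ ^ 2 * C₄ * ‖Complex.Gamma lam‖ * (2 + ‖lam‖) *
      (((4 * r) ^ x.1.1 / x.1.1.factorial * ((4 * r) ^ x.1.2 / x.1.2.factorial)) *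
        (32 ^ x.2 / x.2.factorial))
  have hF : Summable F := by
    refine Summable.mul_left _ ?_
    have hs := Real.summable_pow_div_factorial (4 * r)
    have hs' := Real.summable_pow_div_factorial 32
    have h0 : ∀ n : ℕ, 0 ≤ (4 * r) ^ n / n.factorial := fun n => by positivity
    have h0' : ∀ n : ℕ, (0 : ℝ) ≤ 32 ^ n / n.factorial := fun n => by positivity
    exact (hs.mul_of_nonneg hs h0 h0).mul_of_nonneg hs' (fun x => mul_nonneg (h0 _) (h0 _)) h0'
  refine Summable.of_norm_bounded hF ?_
  rintro ⟨⟨p, q⟩, L⟩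
  have hpoch : ∀ n : ℕ, ‖poch(n, (1 / 2 : ℂ)) / n.factorial‖ ≤ 1 := by
    intro n
    rw [norm_div, Complex.norm_natCast]
    exact div_le_one_of_le₀ (norm_ascPochhammer_half_le n) (by positivity)
  have hdesc : ∀ n : ℕ, ‖(n.descFactorial L : ℂ) * (Complex.Gamma (lam + 1 + (n + L : ℕ)))⁻¹‖ ≤
      C₃ * (2 ^ n * (2 ^ L / L.factorial)) := by
    intro n
    have hle : (n.descFactorial L : ℝ) * L.factorial ≤ (n + L).factorial := by
      have h := Nat.factorial_mul_factorial_dvd_factorial_add n L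
      have h' := Nat.le_of_dvd (Nat.factorial_pos _) h
      have h'' : n.descFactorial L ≤ n.factorial := by
        rcases le_or_gt L n with hL | hL
        · rw [← Nat.factorial_mul_descFactorial hL]
          exact Nat.le_mul_of_pos_left _ (Nat.factorial_pos _)
        · simp [Nat.descFactorial_of_lt hL]
      exact_mod_cast (Nat.mul_le_mul_right _ h'').trans h'
    rw [norm_mul, Complex.norm_natCast]
    calc _ ≤ (n.descFactorial L : ℝ) * (C₃ * (2 ^ (n + L) / (n + L).factorial)) := by
          gcongr
          exact h₃ _
      _ = C₃ * 2 ^ (n + L) * (n.descFactorial L / (n + L).factorial) := by ring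
      _ ≤ C₃ * 2 ^ (n + L) * (1 / L.factorial) := by
          gcongr C₃ * 2 ^ (n + L) * ?_
          rw [div_le_div_iff₀ (by positivity) (by positivity), one_mul]
          exact hle
      _ = _ := by rw [pow_add]; ring
  have hmid : ‖Complex.Gamma lam * (2 * L + lam) * poch(2 * L, 2 * lam) / (2 * L).factorial‖ ≤
      ‖Complex.Gamma lam‖ * ((2 + ‖lam‖) * 2 ^ L) * (C₄ * 4 ^ L) := by
    rw [mul_div_assoc, norm_mul, norm_mul]
    have hL : (L : ℝ) ≤ 2 ^ L := by exact_mod_cast L.lt_two_pow_self.le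
    have hL' : (1 : ℝ) ≤ 2 ^ L := one_le_pow₀ one_le_two
    gcongr
    · refine (norm_add_le _ _).trans ?_
      simp only [norm_mul, Complex.norm_natCast, Complex.norm_ofNat]
      nlinarith [norm_nonneg lam]
    · rw [norm_div, Complex.norm_natCast, div_le_iff₀ (by positivity)]
      refine (h₄ _).trans (le_of_eq ?_)
      rw [pow_mul]
      norm_num
      ring
  have hp : ‖poch(p, (1 / 2 : ℂ)) / p.factorial * (Complex.Gamma (p - μ + 1))⁻¹ * z ^ p‖ ≤
      1 * (C₁ * (2 ^ p / p.factorial)) * r ^ p := by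
    rw [norm_mul, norm_mul, norm_pow]
    gcongr
    · exact hpoch p
    · rw [show (p - μ + 1 : ℂ) = 1 - μ + p by ring]
      exact h₁ p
  have hq : ‖poch(q, (1 / 2 : ℂ)) / q.factorial * (Complex.Gamma (q + μ + 1))⁻¹ * z ^ q‖ ≤
      1 * (C₂ * (2 ^ q / q.factorial)) * r ^ q := by
    rw [norm_mul, norm_mul, norm_pow]
    gcongr
    · exact hpoch q
    · rw [show (q + μ + 1 : ℂ) = 1 + μ + q by ring]
      exact h₂ q
  have hfac : (1 : ℝ) ≤ L.factorial := by exact_mod_cast L.factorial_pos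
  dsimp only
  unfold tripleTerm
  rw [norm_mul, norm_mul, norm_mul, norm_mul]
  calc _ ≤ (1 * (C₁ * (2 ^ p / p.factorial)) * r ^ p) * (1 * (C₂ * (2 ^ q / q.factorial)) * r ^ q) *
        (‖Complex.Gamma lam‖ * ((2 + ‖lam‖) * 2 ^ L) * (C₄ * 4 ^ L)) *
        (C₃ * (2 ^ p * (2 ^ L / L.factorial))) * (C₃ * (2 ^ q * (2 ^ L / L.factorial))) := by
        gcongr
        · exact hdesc p
        · exact hdesc q
    _ = F ((p, q), L) / L.factorial := by
        simp only [F, mul_pow]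
        rw [show (4 : ℝ) ^ p = 2 ^ p * 2 ^ p by rw [← mul_pow]; norm_num,
          show (4 : ℝ) ^ q = 2 ^ q * 2 ^ q by rw [← mul_pow]; norm_num,
          show (32 : ℝ) ^ L = 2 ^ L * 4 ^ L * 2 ^ L * 2 ^ L by
            rw [← mul_pow, ← mul_pow, ← mul_pow]; norm_num]
        field_simp
    _ ≤ F ((p, q), L) := div_le_self (by positivity) hfac

/-- The expansion with the coefficients in closed form, for every `λ` that is not a pole of `Γ`:
both sides are the sum of the absolutely convergent triple series. -/
theorem hasSum_pairCoeffClosed_mul_pairProduct {lam : ℂ} (hlam : ∀ m : ℕ, lam ≠ -m) (k μ : ℂ) :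
    HasSum (fun L : ℕ => pairCoeffClosed k lam L * pairProduct k μ lam L)
      (Complex.regularizedHGFun {1 / 2, 1 / 2} {lam + 1, 1 - μ, μ + 1} (-k ^ 2)) := by
  set z : ℂ := -k ^ 2 / 4 with hz
  obtain ⟨S, hS⟩ := summable_tripleTerm z μ lam
  have hpq := hS.prod_fiberwise fun x => hasSum_tripleTerm_inner hlam z μ x.1 x.2
  have hN := (Finset.HasAntidiagonal.sigmaAntidiagonalEquivProd.hasSum_iff.2 hpq).sigma
    fun N => hasSum_fintype _
  have hHG := hasSum_regularizedHGFun {1 / 2, 1 / 2} {lam + 1, 1 - μ, μ + 1} (by simp) (-k ^ 2)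
  -- Grouping by `N = p + q` gives the power series of the left-hand side.
  have hSeq : Complex.regularizedHGFun {1 / 2, 1 / 2} {lam + 1, 1 - μ, μ + 1} (-k ^ 2) = S := by
    refine hHG.unique (hN.congr_fun fun N => ?_)
    refine Eq.trans ?_ (Finset.sum_attach (Finset.HasAntidiagonal.antidiagonal N)
      (fun x : ℕ × ℕ => ((x.1.factorial : ℂ) * x.2.factorial)⁻¹ *
        (Complex.Gamma (x.1 - μ + 1))⁻¹ * (Complex.Gamma (x.2 + μ + 1))⁻¹ *
        (poch(x.1 + x.2, 1 / 2) * (Complex.Gamma (lam + 1 + (x.1 + x.2 : ℕ)))⁻¹ *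
          z ^ (x.1 + x.2)))).symm
    rw [Finset.sum_congr rfl fun x hx => by rw [Finset.HasAntidiagonal.mem_antidiagonal.1 hx],
      ← Finset.sum_mul, sum_antidiagonal_inv_Gamma,
      show -k ^ 2 = 4 * z by rw [hz]; ring, mul_pow]
    simp only [Complex.regularizedHGFunCoeff, Multiset.map_singleton, Multiset.prod_singleton,
      Multiset.insert_eq_cons, Multiset.map_cons, Multiset.prod_cons, div_eq_mul_inv, mul_inv]
    ring
  rw [hSeq]
  -- The terms vanish unless `L ≤ min p q`, so the index set can be shifted to `(L + i, L + j, L)`.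
  have hinj : Function.Injective
      (fun x : ℕ × (ℕ × ℕ) => ((x.1 + x.2.1, x.1 + x.2.2), x.1)) := by
    rintro ⟨L, i, j⟩ ⟨L', i', j'⟩ h
    simp only [Prod.mk.injEq] at h ⊢
    omega
  have hshift := (hinj.hasSum_iff (f := fun x : (ℕ × ℕ) × ℕ =>
    tripleTerm z μ lam x.1.1 x.1.2 x.2) ?_).2 hS
  · exact hshift.prod_fiberwise fun L => hasSum_tripleTerm_pair k μ lam L
  · rintro ⟨⟨p, q⟩, L⟩ hx
    by_cases hp : L ≤ p
    · by_cases hq : L ≤ q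
      · exact absurd ⟨(L, p - L, q - L), by simp [hp, hq]⟩ hx
      · simp [tripleTerm, Nat.descFactorial_of_lt (not_le.1 hq)]
    · simp [tripleTerm, Nat.descFactorial_of_lt (not_le.1 hp)]

/-! ### The coefficients in closed form -/

theorem ne_neg_natCast_of_two_mul {lam : ℂ} (h : ∀ n : ℕ, 2 * lam ≠ -(n : ℂ)) (m : ℕ) :
    lam ≠ -m := by
  intro hm
  exact h (2 * m) (by rw [hm]; push_cast; ring)

theorem pairCoeff_eq_pairCoeffClosed {lam : ℂ} (hlam : ∀ n : ℕ, 2 * lam ≠ -(n : ℂ)) (k : ℂ)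
    (L : ℕ) : pairCoeff k lam L = pairCoeffClosed k lam L := by
  have hA : ∀ m : ℕ, lam + 1 / 2 ≠ -m := fun m h =>
    hlam (2 * m + 1) (by push_cast; linear_combination 2 * h)
  have hG4 : ∀ m : ℕ, 4 * (L : ℂ) + 2 * lam + 1 ≠ -m := fun m h =>
    hlam (m + 4 * L + 1) (by push_cast; linear_combination h)
  have hA0 := Complex.Gamma_ne_zero hA
  have hG0 := Complex.Gamma_ne_zero hG4
  have hP0 := ascPochhammer_eval_ne_zero hA (2 * L)
  have hR0 := ascPochhammer_eval_ne_zero half_ne_neg_natCast L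
  have hr0 : ((√Real.pi : ℝ) : ℂ) ≠ 0 := by
    exact_mod_cast (Real.sqrt_pos.2 Real.pi_pos).ne'
  have hr2 : (Real.pi : ℂ) = ((√Real.pi : ℝ) : ℂ) ^ 2 := by
    rw [← Complex.ofReal_pow, Real.sq_sqrt Real.pi_pos.le]
  have hW0 : (2 : ℂ) ^ (2 * lam) ≠ 0 := by simp [Complex.cpow_eq_zero_iff]
  have hL0 : (L.factorial : ℂ) ≠ 0 := by exact_mod_cast L.factorial_ne_zero
  have e1 : Complex.Gamma ((L : ℂ) + 1 / 2) = ((√Real.pi : ℝ) : ℂ) * poch(L, 1 / 2) := by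
    rw [add_comm, Gamma_add_nat_eq_mul_ascPochhammer half_ne_neg_natCast,
      Complex.Gamma_one_half_eq, Real.sqrt_eq_rpow, Complex.ofReal_cpow Real.pi_pos.le]
    norm_num
  -- Duplication at `2L + λ + 1/2`.
  have e2 : poch(2 * L, lam + 1 / 2) * Complex.Gamma (lam + 1 / 2) *
      Complex.Gamma (2 * L + lam + 1) =
        Complex.Gamma (4 * L + 2 * lam + 1) * ((16 : ℂ) ^ L * 2 ^ (2 * lam))⁻¹ *
          ((√Real.pi : ℝ) : ℂ) := by
    have h := Complex.Gamma_mul_Gamma_add_half (lam + 1 / 2 + (2 * L : ℕ))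
    rw [Gamma_add_nat_eq_mul_ascPochhammer hA,
      show lam + 1 / 2 + ((2 * L : ℕ) : ℂ) + 1 / 2 = 2 * L + lam + 1 by push_cast; ring,
      show 2 * (lam + 1 / 2 + ((2 * L : ℕ) : ℂ)) = 4 * L + 2 * lam + 1 by push_cast; ring,
      show 1 - (4 * L + 2 * lam + 1) = -(((4 * L : ℕ) : ℂ) + 2 * lam) by push_cast; ring,
      Complex.cpow_neg, Complex.cpow_add _ _ two_ne_zero, Complex.cpow_natCast, pow_mul] at h
    norm_num at h ⊢
    linear_combination h
  have e3 : Complex.Gamma (2 * L + 2 * lam) = Complex.Gamma (2 * lam) * poch(2 * L, 2 * lam) := by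
    rw [← Gamma_add_nat_eq_mul_ascPochhammer hlam]
    push_cast
    ring_nf
  -- Duplication at `λ`.
  have e4 : Complex.Gamma lam * Complex.Gamma (lam + 1 / 2) =
      Complex.Gamma (2 * lam) * (2 * (2 ^ (2 * lam))⁻¹) * ((√Real.pi : ℝ) : ℂ) := by
    rw [Complex.Gamma_mul_Gamma_add_half, sub_eq_add_neg, Complex.cpow_add _ _ two_ne_zero,
      Complex.cpow_neg, Complex.cpow_one]
  have e5 : (2 : ℂ) ^ (2 * (L : ℂ) + 2 * lam + 1) = 4 ^ L * 2 ^ (2 * lam) * 2 := by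
    rw [show 2 * (L : ℂ) + 2 * lam + 1 = ((2 * L : ℕ) : ℂ) + 2 * lam + 1 by push_cast; ring,
      Complex.cpow_add _ _ two_ne_zero, Complex.cpow_add _ _ two_ne_zero, Complex.cpow_natCast,
      Complex.cpow_one, pow_mul]
    norm_num
  have e6 : Complex.Gamma (2 * lam) = Complex.Gamma lam * Complex.Gamma (lam + 1 / 2) *
      2 ^ (2 * lam) / (2 * ((√Real.pi : ℝ) : ℂ)) := by
    rw [e4]
    field_simp
  have e7 : Complex.Gamma (2 * L + lam + 1) = Complex.Gamma (4 * L + 2 * lam + 1) *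
      ((16 : ℂ) ^ L * 2 ^ (2 * lam))⁻¹ * ((√Real.pi : ℝ) : ℂ) /
        (poch(2 * L, lam + 1 / 2) * Complex.Gamma (lam + 1 / 2)) := by
    rw [eq_div_iff (mul_ne_zero hP0 hA0), ← e2]
    ring
  have e8 : (16 : ℂ) ^ L = 4 ^ L * 4 ^ L := by
    rw [← mul_pow]
    norm_num
  rw [pairCoeff, pairCoeffClosed, e1, e3, e5, e6, e7, e8, hr2, factorial_two_mul_eq,
    Complex.Gamma_nat_eq_factorial, pow_mul (-1 : ℂ), neg_one_sq, one_pow, one_mul]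
  generalize Complex.Gamma (lam + 1 / 2) = A at *
  generalize poch(2 * L, lam + 1 / 2) = P at *
  generalize Complex.Gamma (4 * L + 2 * lam + 1) = G at *
  field_simp

theorem continuousAt_pairCoeffClosed {lam : ℂ} (hlam : ∀ m : ℕ, lam ≠ -m) (k : ℂ) (L : ℕ) :
    ContinuousAt (fun lam => pairCoeffClosed k lam L) lam := by
  have h1 : ContinuousAt Complex.Gamma lam := (Complex.differentiableAt_Gamma lam hlam).continuousAt
  have h2 : Continuous fun lam : ℂ => poch(2 * L, 2 * lam) :=
    (ascPochhammer ℂ (2 * L)).continuous.comp (continuous_const.mul continuous_id)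
  unfold pairCoeffClosed
  have h2' := h2.continuousAt (x := lam)
  fun_prop

/-- The values of `λ` with `2λ ∈ {0, -1, -2, …}` are spaced `1/2` apart, so `-n - 1/2` has a
punctured neighbourhood free of them. -/
theorem eventually_two_mul_ne_neg_natCast (n : ℕ) :
    ∀ᶠ lam in 𝓝[≠] (-(n : ℂ) - 1 / 2), ∀ m : ℕ, 2 * lam ≠ -(m : ℂ) := by
  filter_upwards [self_mem_nhdsWithin,
    mem_nhdsWithin_of_mem_nhds (Metric.ball_mem_nhds (-(n : ℂ) - 1 / 2) one_half_pos)]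
    with lam hne hball m hm
  have hdist : 2 * (lam - (-(n : ℂ) - 1 / 2)) = ((2 * n + 1 - m : ℤ) : ℂ) := by
    push_cast
    linear_combination hm
  have hlt : ‖((2 * n + 1 - m : ℤ) : ℂ)‖ < 1 := by
    rw [← hdist, norm_mul, Complex.norm_ofNat]
    rw [mem_ball_iff_norm] at hball
    linarith
  rw [Complex.norm_intCast, ← Int.cast_abs] at hlt
  have hzero : (2 * n + 1 - m : ℤ) = 0 := Int.abs_lt_one_iff.1 (by exact_mod_cast hlt)
  rw [hzero, Int.cast_zero] at hdist
  exact hne (sub_eq_zero.1 ((mul_eq_zero.1 hdist).resolve_left two_ne_zero))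

theorem mainTheorem6 (k μ : ℂ) :
    (∀ lam : ℂ, (∀ n : ℕ, 2 * lam ≠ -(n : ℂ)) →
      HasSum (fun L : ℕ => pairCoeff k lam L * pairProduct k μ lam L)
        (Complex.regularizedHGFun {1 / 2, 1 / 2} {lam + 1, 1 - μ, μ + 1} (-k ^ 2))) ∧
    (∀ n : ℕ, ∀ lam₀ : ℂ, lam₀ = -(n : ℂ) - 1 / 2 →
      ∃ C : ℕ → ℂ,
        (∀ L : ℕ, Tendsto (fun lam : ℂ => pairCoeff k lam L) (𝓝[≠] lam₀) (𝓝 (C L))) ∧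
        HasSum (fun L : ℕ => C L * pairProduct k μ lam₀ L)
          (Complex.regularizedHGFun {1 / 2, 1 / 2} {lam₀ + 1, 1 - μ, μ + 1} (-k ^ 2))) := by
  refine ⟨fun lam hlam => ?_, ?_⟩
  · simp only [pairCoeff_eq_pairCoeffClosed hlam]
    exact hasSum_pairCoeffClosed_mul_pairProduct (ne_neg_natCast_of_two_mul hlam) k μ
  · rintro n lam₀ rfl
    have hlam : ∀ m : ℕ, (-(n : ℂ) - 1 / 2) ≠ -m := by
      intro m h
      have h' : ((2 * n + 1 : ℕ) : ℂ) = ((2 * m : ℕ) : ℂ) := by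
        push_cast
        linear_combination -2 * h
      have := Nat.cast_injective h'
      omega
    refine ⟨pairCoeffClosed k (-(n : ℂ) - 1 / 2), fun L => ?_,
      hasSum_pairCoeffClosed_mul_pairProduct hlam k μ⟩
    refine ((continuousAt_pairCoeffClosed hlam k L).tendsto.mono_left nhdsWithin_le_nhds).congr' ?_
    filter_upwards [eventually_two_mul_ne_neg_natCast n] with lam h
    exact (pairCoeff_eq_pairCoeffClosed h k L).symm
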